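/- Let $F$ be an Archimedean vector lattice (real Riesz space). Vectors $x,y\in F$ are disjoint if $|x|\wedge|y|=0$; a set $G\subset F$ is disjoint if any two distinct elements of $G$ are disjoint; $G^{d}$ is the set of all $f\in F$ that are disjoint from every element of $G$, and $G^{dd}=(G^{d})^{d}$. A set is order bounded if it is contained in some order interval $[a,b]$ of $F$. An ideal is a solid linear subspace of $F$; a band is an ideal that contains the supremum of each of its subsets for which the supremum exists in $F$; an ideal $H$ is a projection band if $F=H+H^{d}$. $F$ has the projection property (PP) if every band in $F$ is a projection band, and has $\sigma$-PP if every band generated by a countable set is a projection band. $F$ is disjointly complete (resp. disjointly $\sigma$-complete) if every non-empty (resp. non-empty countable) order bounded disjoint subset of $F$ has a supremum in $F$. Countable sets may be finite. Then: 1. $F$ has PP if and only if for every order bounded disjoint set $G\subset F$ there is $g\in G^{dd}$ such that $x\le g$ for all $x\in G$. 2. $F$ has $\sigma$-PP if and only if for every countable order bounded disjoint set $G\subset F$ there is $g\in G^{dd}$ such that $x\le g$ for all $x\in G$. 3. If $F$ is disjointly complete, then $F$ has PP; if $F$ is disjointly $\sigma$-complete, then $F$ has $\sigma$-PP. -/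

import Mathlib

/-!  Vector lattices are real vector spaces with a lattice order compatible with addition and with
multiplication by non-negative scalars, i.e. types carrying
`[AddCommGroup F] [Lattice F] [IsOrderedAddMonoid F] [Module ℝ F] [IsOrderedModule ℝ F]`. -/

namespace VectorLattice

/-- `F` is Archimedean: if `n x ≤ y` for all `n ∈ ℕ`, then `x ≤ 0`. (Mathlib's class `Archimedean`
is a different, much stronger condition when the order is not total.) -/
def IsArchimedean (F : Type*) [AddCommGroup F] [Lattice F] : Prop :=
  ∀ x y : F, (∀ n : ℕ, n • x ≤ y) → x ≤ 0

/-- Two vectors are disjoint if `|x| ∧ |y| = 0`. -/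
def Disj {F : Type*} [AddCommGroup F] [Lattice F] (x y : F) : Prop :=
  |x| ⊓ |y| = 0

/-- A set of vectors is disjoint if any two distinct members of it are disjoint. -/
def IsDisjointSet {F : Type*} [AddCommGroup F] [Lattice F] (G : Set F) : Prop :=
  G.Pairwise Disj

/-- The disjoint complement `Gᵈ`. -/
def disjCompl {F : Type*} [AddCommGroup F] [Lattice F] (G : Set F) : Set F :=
  {f | ∀ g ∈ G, Disj f g}

/-- Order bounded sets: those contained in an order interval. -/
def IsOrderBounded {F : Type*} [AddCommGroup F] [Lattice F] (G : Set F) : Prop :=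
  ∃ a b : F, G ⊆ Set.Icc a b

/-- (Order) ideals: solid linear subspaces. -/
def IsIdeal {F : Type*} [AddCommGroup F] [Lattice F] [Module ℝ F] (H : Submodule ℝ F) : Prop :=
  ∀ ⦃x y : F⦄, |x| ≤ |y| → y ∈ H → x ∈ H

/-- Bands: ideals that contain the supremum of any of their subsets, whenever it exists in `F`. -/
def IsBand {F : Type*} [AddCommGroup F] [Lattice F] [Module ℝ F] (H : Submodule ℝ F) : Prop :=
  IsIdeal H ∧ ∀ (S : Set F) (s : F), S ⊆ H → IsLUB S s → s ∈ H

/-- Projection bands: ideals `H` such that `F = H + Hᵈ`. -/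
def IsProjectionBand {F : Type*} [AddCommGroup F] [Lattice F] [Module ℝ F]
    (H : Submodule ℝ F) : Prop :=
  IsIdeal H ∧ ∀ f : F, ∃ h ∈ H, ∃ k ∈ disjCompl (H : Set F), f = h + k

/-- `H` is the band generated by `S`: the smallest band that contains `S`. -/
def IsBandGeneratedBy {F : Type*} [AddCommGroup F] [Lattice F] [Module ℝ F]
    (H : Submodule ℝ F) (S : Set F) : Prop :=
  IsLeast {B : Submodule ℝ F | IsBand B ∧ S ⊆ B} H

/-- The projection property (PP): every band is a projection band. -/
def HasPP (F : Type*) [AddCommGroup F] [Lattice F] [Module ℝ F] : Prop :=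
  ∀ H : Submodule ℝ F, IsBand H → IsProjectionBand H

/-- The property σ-PP: every band generated by a countable set is a projection band. -/
def HasSigmaPP (F : Type*) [AddCommGroup F] [Lattice F] [Module ℝ F] : Prop :=
  ∀ (H : Submodule ℝ F) (S : Set F), S.Countable → IsBandGeneratedBy H S → IsProjectionBand H

/-- Disjoint completeness: every non-empty order bounded disjoint set has a supremum. (The empty
set has a supremum only in the zero space.) -/
def DisjointlyComplete (F : Type*) [AddCommGroup F] [Lattice F] : Prop :=
  ∀ G : Set F, G.Nonempty → IsOrderBounded G → IsDisjointSet G → ∃ s : F, IsLUB G s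

/-- Disjoint σ-completeness: every non-empty countable order bounded disjoint set has a
supremum. -/
def DisjointlySigmaComplete (F : Type*) [AddCommGroup F] [Lattice F] : Prop :=
  ∀ G : Set F, G.Nonempty → G.Countable → IsOrderBounded G → IsDisjointSet G →
    ∃ s : F, IsLUB G s

end VectorLattice

/-!
Disjoint complements are bands, and in an Archimedean vector lattice every band `H` satisfies
`H = Hᵈᵈ` (`IsBand.disjCompl_disjCompl_subset`); in particular `Gᵈᵈ` is the band generated by `G`.
Hence, if `Gᵈᵈ` is a projection band, the projection of an upper bound of `G` is an upper bound of
`G` in `Gᵈᵈ`, and if `G` has a supremum, the supremum lies in `Gᵈᵈ`. What remains is to construct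
projections from upper bounds of disjoint sets.

For a principal band `eᵈᵈ` with `e ≥ 0`, and `f ≥ 0`, think of `e` and `f` as functions and of
`r = f / e`. Cutting `f` down to a neighbourhood of the set where `n ≤ r ≤ n + 1` can be done with
lattice operations; the resulting vectors `window e f n` lie in `eᵈᵈ ∩ [0, f]`, and they are
disjoint for indices at distance at least `3`. So they form three disjoint sequences, and upper
bounds of these give `g ∈ eᵈᵈ ∩ [0, f]` that dominates all windows. Where `e > 0` the number `r`
is finite, hence in some `[n, n + 1]`, where `f` agrees with a window; so `f - g` is disjoint from
`e`. The rigorous form of the last step is `eq_zero_of_le_sub_window`, which rests on the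
Archimedean property.

For a general band `H`, take a disjoint set `D ⊆ H` with `Dᵈ = Hᵈ`: a maximal disjoint subset of
`H`, or, if `H` is generated by a sequence, its orthogonalization by means of principal
projections, which is countable. The projections of `f ≥ 0` onto the bands `dᵈᵈ`, `d ∈ D`, form a
disjoint set bounded by `f`, and an upper bound `g ∈ H` of it makes `f - |g| ⊓ f` disjoint from
`D`, hence from `H` (`isProjectionBand_of_disjoint_generators`).
-/

namespace VectorLattice

/-! ### Disjointness in lattice-ordered groups -/

section LatticeGroup

variable {F : Type*} [AddCommGroup F] [Lattice F]

theorem Disj.symm {x y : F} (h : Disj x y) : Disj y x := by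
  unfold Disj at *
  rwa [inf_comm]

theorem disjCompl_anti {A B : Set F} (h : A ⊆ B) : disjCompl B ⊆ disjCompl A :=
  fun _ hf g hg => hf g (h hg)

theorem subset_disjCompl_disjCompl (A : Set F) : A ⊆ disjCompl (disjCompl A) :=
  fun _ hx _ hg => (hg _ hx).symm

variable [IsOrderedAddMonoid F]

theorem Disj.mono_left {x y z : F} (h : Disj x y) (hz : |z| ≤ |x|) : Disj z y :=
  le_antisymm ((inf_le_inf_right _ hz).trans h.le) (le_inf (abs_nonneg _) (abs_nonneg _))

theorem Disj.mono_right {x y z : F} (h : Disj x y) (hz : |z| ≤ |y|) : Disj x z :=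
  (h.symm.mono_left hz).symm

theorem disj_zero_left (y : F) : Disj 0 y := by
  simp [Disj]

theorem disj_posPart_negPart (x : F) : Disj x⁺ x⁻ := by
  rw [Disj, abs_of_nonneg (posPart_nonneg x), abs_of_nonneg (negPart_nonneg x),
    posPart_inf_negPart_eq_zero]

theorem add_inf_le_of_nonneg {a b c : F} (ha : 0 ≤ a) (hb : 0 ≤ b) (hc : 0 ≤ c) :
    (a + b) ⊓ c ≤ a ⊓ c + b ⊓ c := by
  rw [add_inf, inf_add, inf_add]
  refine le_inf (le_inf inf_le_left ?_) (le_inf ?_ ?_)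
  · exact inf_le_right.trans (le_add_of_nonneg_right hb)
  · exact inf_le_right.trans (le_add_of_nonneg_left ha)
  · exact inf_le_right.trans (le_add_of_nonneg_right hc)

theorem Disj.add_left {x y z : F} (hx : Disj x z) (hy : Disj y z) : Disj (x + y) z := by
  refine le_antisymm ?_ (le_inf (abs_nonneg _) (abs_nonneg _))
  calc |x + y| ⊓ |z| ≤ (|x| + |y|) ⊓ |z| := inf_le_inf_right _ (abs_add_le x y)
    _ ≤ |x| ⊓ |z| + |y| ⊓ |z| :=
      add_inf_le_of_nonneg (abs_nonneg _) (abs_nonneg _) (abs_nonneg _)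
    _ = 0 := by rw [show |x| ⊓ |z| = 0 from hx, show |y| ⊓ |z| = 0 from hy, add_zero]

theorem Disj.nsmul_left {x z : F} (hx : Disj x z) (n : ℕ) : Disj (n • x) z := by
  induction n with
  | zero => rw [zero_smul]; exact disj_zero_left z
  | succ n ih => rw [succ_nsmul]; exact ih.add_left hx

theorem Disj.add_right {x y z : F} (hx : Disj z x) (hy : Disj z y) : Disj z (x + y) :=
  (hx.symm.add_left hy.symm).symm

theorem Disj.nsmul_right {x z : F} (hx : Disj z x) (n : ℕ) : Disj z (n • x) :=
  (hx.symm.nsmul_left n).symm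

theorem Disj.eq_zero_of_le {x y : F} (h : Disj x y) (hx : 0 ≤ x) (hxy : x ≤ y) : x = 0 := by
  unfold Disj at h
  rwa [abs_of_nonneg hx, abs_of_nonneg (hx.trans hxy), inf_eq_left.2 hxy] at h

theorem Disj.eq_zero {x : F} (h : Disj x x) : x = 0 := by
  unfold Disj at h
  rw [inf_idem] at h
  exact le_antisymm ((le_abs_self x).trans h.le)
    (neg_nonpos.1 ((neg_le_abs x).trans h.le))

theorem Disj.add_le_of_le {x y s : F} (h : Disj x y) (hx : 0 ≤ x) (hy : 0 ≤ y) (hxs : x ≤ s)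
    (hys : y ≤ s) : x + y ≤ s := by
  have h' := inf_add_sup x y
  unfold Disj at h
  rw [abs_of_nonneg hx, abs_of_nonneg hy] at h
  rw [h, zero_add] at h'
  exact h' ▸ sup_le hxs hys

theorem abs_posPart_le (x : F) : |x⁺| ≤ |x| := by
  rw [abs_of_nonneg (posPart_nonneg x)]
  exact sup_le (le_abs_self x) (abs_nonneg x)

theorem abs_negPart_le (x : F) : |x⁻| ≤ |x| := by
  rw [abs_of_nonneg (negPart_nonneg x)]
  exact sup_le (neg_le_abs x) (abs_nonneg x)

/-- Projections onto bands are positive: a non-negative sum of two disjoint vectors has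
non-negative summands. -/
theorem Disj.nonneg_of_add_nonneg {u k : F} (h : Disj u k) (huk : 0 ≤ u + k) : 0 ≤ u := by
  have h1 : Disj u⁻ (u⁺ + |k|) :=
    (disj_posPart_negPart u).symm.add_right
      ((h.mono_left (abs_negPart_le u)).mono_right (abs_abs k).le)
  have h2 : u⁻ ≤ u⁺ + |k| := by
    rw [← posPart_sub_negPart u] at huk
    have : u⁻ ≤ u⁺ + k := by
      rw [← sub_nonneg]; convert huk using 1; abel
    exact this.trans (by gcongr; exact le_abs_self k)
  exact negPart_eq_zero.1 (h1.eq_zero_of_le (negPart_nonneg u) h2)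

/-- If `s` is the supremum of a set of vectors disjoint from `g`, then `s` is disjoint from `g`. -/
theorem disj_of_isLUB {S : Set F} {s g : F} (hS : ∀ x ∈ S, Disj x g) (hs : IsLUB S s) :
    Disj s g := by
  rcases S.eq_empty_or_nonempty with rfl | ⟨x₀, hx₀⟩
  · have hbot : ∀ y, s ≤ y := by simpa [IsLUB, IsLeast, upperBounds, lowerBounds] using hs
    have : s = 0 := le_antisymm (hbot 0) ((le_add_iff_nonneg_right s).1 (hbot (s + s)))
    rw [this]
    exact disj_zero_left g
  have hneg : Disj s⁻ g := by
    refine (hS x₀ hx₀).mono_left (le_trans ?_ (abs_negPart_le x₀))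
    rw [abs_of_nonneg (negPart_nonneg _), abs_of_nonneg (negPart_nonneg _)]
    exact negPart_anti (hs.1 hx₀)
  -- The part `w` of `s⁺` that meets `g` can be removed from the upper bound `s`.
  set w := s⁺ ⊓ |g| with hw
  have hw0 : 0 ≤ w := le_inf (posPart_nonneg s) (abs_nonneg g)
  have hub : s ≤ s - w := by
    refine hs.2 fun x hx => ?_
    have h1 : Disj (x + s⁻)⁺ w := by
      refine (((hS x hx).add_left hneg).mono_left (abs_posPart_le _)).mono_right ?_
      rw [abs_of_nonneg hw0]
      exact inf_le_right
    have h2 : (x + s⁻)⁺ ≤ s⁺ := by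
      refine sup_le ?_ (posPart_nonneg s)
      calc x + s⁻ ≤ s + s⁻ := by gcongr; exact hs.1 hx
        _ = s⁺ := by rw [← sub_eq_iff_eq_add.1 (posPart_sub_negPart s)]
    have h3 := h1.add_le_of_le (posPart_nonneg _) hw0 h2 inf_le_left
    have h4 : x + s⁻ + w ≤ s⁺ := le_trans (by gcongr; exact le_posPart _) h3
    rw [sub_eq_iff_eq_add.1 (posPart_sub_negPart s)] at h4
    rw [le_sub_iff_add_le]
    exact le_of_add_le_add_right (a := s⁻) (by rwa [add_right_comm])
  have hw' : w = 0 := le_antisymm (by simpa using hub) hw0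
  have hpos : Disj s⁺ g := by
    rw [Disj, abs_of_nonneg (posPart_nonneg s)]
    exact hw'
  have := hpos.add_left (hneg.mono_left (abs_neg s⁻).le)
  rwa [← sub_eq_add_neg, posPart_sub_negPart] at this

end LatticeGroup

/-! ### Windows of the quotient of two vectors -/

section Windows

variable {F : Type*} [AddCommGroup F] [Lattice F]

/-- With `r` denoting the quotient `f / e`, the vector `f ⊓ (n + 1) • a`, where `a` is supported
where `n - 1 < r < n + 2`; it agrees with `f` where `n ≤ r ≤ n + 1`. -/
def window (e f : F) (n : ℕ) : F :=
  f ⊓ (n + 1) • ((f + e - n • e)⁺ ⊓ ((n + 2) • e - f)⁺)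

theorem window_le (e f : F) (n : ℕ) : window e f n ≤ f := inf_le_left

variable [IsOrderedAddMonoid F]

theorem window_nonneg {e f : F} (hf : 0 ≤ f) (n : ℕ) : 0 ≤ window e f n :=
  le_inf hf (nsmul_nonneg (le_inf (posPart_nonneg _) (posPart_nonneg _)) _)

theorem window_le_nsmul {e f : F} (he : 0 ≤ e) (hf : 0 ≤ f) (n : ℕ) :
    window e f n ≤ ((n + 1) * (n + 2)) • e := by
  refine inf_le_right.trans ?_
  rw [mul_smul]
  refine nsmul_le_nsmul_right (inf_le_right.trans (sup_le ?_ (nsmul_nonneg he _))) _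
  exact sub_le_self _ hf

theorem disj_window_window {e f : F} (he : 0 ≤ e) (hf : 0 ≤ f) {m n : ℕ} (h : n + 3 ≤ m) :
    Disj (window e f n) (window e f m) := by
  have h1 : Disj ((n + 1) • ((n + 2) • e - f)⁺) ((m + 1) • ((n + 2) • e - f)⁻) :=
    ((disj_posPart_negPart _).nsmul_left _).nsmul_right _
  refine (h1.mono_left ?_).mono_right ?_
  · rw [abs_of_nonneg (window_nonneg hf n), abs_of_nonneg (nsmul_nonneg (posPart_nonneg _) _)]
    exact inf_le_right.trans (nsmul_le_nsmul_right inf_le_right _)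
  · rw [abs_of_nonneg (window_nonneg hf m), abs_of_nonneg (nsmul_nonneg (negPart_nonneg _) _)]
    refine inf_le_right.trans (nsmul_le_nsmul_right (inf_le_left.trans ?_) _)
    refine sup_le (le_trans ?_ (neg_le_negPart _)) (negPart_nonneg _)
    have h2 : (n + 2) • e + e ≤ m • e := by
      rw [← succ_nsmul]
      exact nsmul_le_nsmul_left he h
    rw [neg_sub, sub_le_sub_iff, add_assoc, add_comm e]
    exact add_le_add le_rfl h2

/-- A vector `x ≥ 0` that is dominated by `e` and by all the remainders `f - window e f n` vanishes. -/
theorem eq_zero_of_le_sub_window (hF : IsArchimedean F) {e f x : F}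
    (hf : 0 ≤ f) (hx : 0 ≤ x) (hxe : x ≤ e) (hxv : ∀ n, x ≤ f - window e f n) : x = 0 := by
  have he : 0 ≤ e := hx.trans hxe
  -- On the support of `x` the quotient `f / e` is at least `n`, for every `n`.
  have key : ∀ n : ℕ, Disj x (n • e - f)⁺ := by
    intro n
    induction n with
    | zero =>
      rw [zero_smul, zero_sub, posPart_eq_zero.2 (neg_nonpos.2 hf)]
      exact (disj_zero_left x).symm
    | succ n ih =>
      set p := (n • e - f)⁺ with hp
      set q := ((n + 1) • e - f)⁻ with hq
      have hp0 : 0 ≤ p := posPart_nonneg _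
      have hq0 : 0 ≤ q := negPart_nonneg _
      have hp1 : n • e - f ≤ p := le_posPart _
      have hq1 : f - (n + 1) • e ≤ q := by rw [← neg_sub]; exact neg_le_negPart _
      set y := x ⊓ ((n + 1) • e - f)⁺ with hy
      have hy0 : 0 ≤ y := le_inf hx (posPart_nonneg _)
      have hyp : Disj y p := ih.mono_left (by
        rw [abs_of_nonneg hy0, abs_of_nonneg hx]; exact inf_le_left)
      have hyq : Disj y q := (disj_posPart_negPart _).mono_left (by
        rw [abs_of_nonneg hy0, abs_of_nonneg (posPart_nonneg _)]; exact inf_le_right)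
      have ha : e - (p + q) ≤ (f + e - n • e)⁺ ⊓ ((n + 2) • e - f)⁺ := by
        refine le_inf (le_trans ?_ (le_posPart _)) (le_trans ?_ (le_posPart _))
        · calc e - (p + q) ≤ e - (n • e - f + 0) := by gcongr
            _ = f + e - n • e := by abel
        · calc e - (p + q) ≤ e - (0 + (f - (n + 1) • e)) := by gcongr
            _ = (n + 2) • e - f := by simp only [add_smul, one_smul, two_smul]; abel
      have hfe : f ≤ (n + 1) • e + (p + q) := by
        rw [← sub_le_iff_le_add']
        exact hq1.trans (le_add_of_nonneg_left hp0)
      have hv : f - (n + 2) • (p + q) ≤ window e f n := by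
        refine le_inf (sub_le_self _ (nsmul_nonneg (add_nonneg hp0 hq0) _)) ?_
        calc f - (n + 2) • (p + q)
            ≤ (n + 1) • e + (p + q) - (n + 2) • (p + q) := by gcongr
          _ = (n + 1) • (e - (p + q)) := by
            rw [smul_sub, succ_nsmul (p + q) (n + 1)]; abel
          _ ≤ _ := nsmul_le_nsmul_right ha _
      have hy_le : y ≤ (n + 2) • (p + q) :=
        inf_le_left.trans ((hxv n).trans (sub_le_comm.1 hv))
      have hy_eq : y = 0 := ((hyp.add_right hyq).nsmul_right _).eq_zero_of_le hy0 hy_le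
      rw [Disj, abs_of_nonneg hx, abs_of_nonneg (posPart_nonneg _)]
      exact hy_eq
  refine le_antisymm (hF x f fun n => ?_) hx
  have h1 : Disj (n • x - f)⁺ (n • e - f)⁺ := by
    refine ((key n).nsmul_left n).mono_left ?_
    rw [abs_of_nonneg (posPart_nonneg _), abs_of_nonneg (nsmul_nonneg hx n)]
    exact sup_le (sub_le_self _ hf) (nsmul_nonneg hx n)
  have h2 : (n • x - f)⁺ ≤ (n • e - f)⁺ :=
    posPart_mono (sub_le_sub_right (nsmul_le_nsmul_right hxe n) f)
  exact sub_nonpos.1 (posPart_eq_zero.1 (h1.eq_zero_of_le (posPart_nonneg _) h2))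

end Windows

/-! ### Disjoint complements and bands -/

section Bands

variable {F : Type*} [AddCommGroup F] [Lattice F] [IsOrderedAddMonoid F]
  [Module ℝ F]

theorem IsIdeal.abs_mem {H : Submodule ℝ F} (hH : IsIdeal H) {x : F} (hx : x ∈ H) : |x| ∈ H :=
  hH (abs_abs x).le hx

theorem IsIdeal.mem_of_nonneg_of_le {H : Submodule ℝ F} (hH : IsIdeal H) {x y : F} (hx : 0 ≤ x)
    (hxy : x ≤ y) (hy : y ∈ H) : x ∈ H :=
  hH (by rwa [abs_of_nonneg hx, abs_of_nonneg (hx.trans hxy)]) hy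

/-- A maximal disjoint subset `D` of an ideal `H` satisfies `Dᵈ ⊆ Hᵈ`. -/
theorem IsIdeal.exists_disjoint_generators {H : Submodule ℝ F} (hH : IsIdeal H) :
    ∃ D : Set F, D ⊆ H ∧ IsDisjointSet D ∧ disjCompl D ⊆ disjCompl (H : Set F) := by
  obtain ⟨D, hD⟩ := zorn_subset {D : Set F | D ⊆ H ∧ IsDisjointSet D} (by
    intro c hc hchain
    refine ⟨⋃₀ c, ⟨Set.sUnion_subset fun s hs => (hc hs).1, ?_⟩,
      fun s hs => Set.subset_sUnion_of_mem hs⟩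
    exact (Set.pairwise_sUnion hchain.directedOn).2 fun s hs => (hc hs).2)
  refine ⟨D, hD.prop.1, hD.prop.2, fun x hx h hh => ?_⟩
  -- `|x| ⊓ |h|` is disjoint from `D`, so it can be added to `D`; by maximality it lies in `D`.
  set y := |x| ⊓ |h| with hy
  have hy0 : 0 ≤ y := le_inf (abs_nonneg _) (abs_nonneg _)
  have hyD : ∀ d ∈ D, Disj y d := fun d hd => (hx d hd).mono_left (by
    rw [abs_of_nonneg hy0]; exact inf_le_left)
  have hins : insert y D ∈ {D : Set F | D ⊆ H ∧ IsDisjointSet D} :=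
    ⟨Set.insert_subset (hH.mem_of_nonneg_of_le hy0 inf_le_right (hH.abs_mem hh)) hD.prop.1,
      hD.prop.2.insert fun d hd _ => ⟨hyD d hd, (hyD d hd).symm⟩⟩
  have hmem : y ∈ D := hD.le_of_ge hins (Set.subset_insert y D) (Set.mem_insert y D)
  exact (hyD y hmem).eq_zero

variable [IsOrderedModule ℝ F]

theorem abs_smul_le_nsmul {r : ℝ} {n : ℕ} (h : |r| ≤ n) (x : F) : |r • x| ≤ |(n • |x|)| := by
  have key : ∀ (t : ℝ) (y : F), |t| ≤ n → t • y ≤ n • |y| := fun t y ht => by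
    have h1 : t • y ≤ |t| • |y| := by
      rcases le_total 0 t with h0 | h0
      · rw [abs_of_nonneg h0]
        exact smul_le_smul_of_nonneg_left (le_abs_self y) h0
      · rw [abs_of_nonpos h0, ← neg_smul_neg]
        exact smul_le_smul_of_nonneg_left (neg_le_abs y) (neg_nonneg.2 h0)
    rw [← Nat.cast_smul_eq_nsmul ℝ]
    exact h1.trans (smul_le_smul_of_nonneg_right ht (abs_nonneg y))
  refine le_trans (abs_le'.2 ⟨key r x h, ?_⟩) (le_abs_self _)
  rw [← neg_smul]
  exact key (-r) x (by rwa [abs_neg])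

theorem Disj.smul_left {x z : F} (hx : Disj x z) (r : ℝ) : Disj (r • x) z := by
  obtain ⟨n, hn⟩ := exists_nat_ge |r|
  exact ((hx.mono_left (abs_abs x).le).nsmul_left n).mono_left (abs_smul_le_nsmul hn x)

/-- The disjoint complement `Gᵈ` as a linear subspace. -/
def disjComplSubmodule (G : Set F) : Submodule ℝ F where
  carrier := disjCompl G
  add_mem' hx hy g hg := (hx g hg).add_left (hy g hg)
  zero_mem' g _ := disj_zero_left g
  smul_mem' r _ hx g hg := (hx g hg).smul_left r

theorem isBand_disjComplSubmodule (G : Set F) : IsBand (disjComplSubmodule G) :=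
  ⟨fun _ _ hxy hy g hg => (hy g hg).mono_left hxy,
    fun _ _ hS hs g hg => disj_of_isLUB (fun _ hx => hS hx g hg) hs⟩

/-- In an Archimedean vector lattice every band equals its double disjoint complement: a positive
`f ∈ Hᵈᵈ` is the supremum of the elements of `H` in `[0, f]`. -/
theorem IsBand.disjCompl_disjCompl_subset (hF : IsArchimedean F) {H : Submodule ℝ F}
    (hH : IsBand H) : disjCompl (disjCompl (H : Set F)) ⊆ H := by
  have hdd := (isBand_disjComplSubmodule (disjCompl (H : Set F))).1
  have key : ∀ f ∈ disjComplSubmodule (disjCompl (H : Set F)), 0 ≤ f → f ∈ H := by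
    intro f hf hf0
    refine hH.2 {h | h ∈ H ∧ 0 ≤ h ∧ h ≤ f} f (fun h hh => hh.1) ⟨fun h hh => hh.2.2, ?_⟩
    intro z hz
    have hz0 : 0 ≤ z := hz ⟨H.zero_mem, le_rfl, hf0⟩
    set w := f - f ⊓ z with hw
    have hw0 : 0 ≤ w := sub_nonneg.2 inf_le_left
    have hwf : w ≤ f := sub_le_self _ (le_inf hf0 hz0)
    have hwd : w ∈ disjCompl (H : Set F) := by
      intro h hh
      rw [Disj, abs_of_nonneg hw0]
      have hv0 : 0 ≤ w ⊓ |h| := le_inf hw0 (abs_nonneg h)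
      have hvH : w ⊓ |h| ∈ H := hH.1.mem_of_nonneg_of_le hv0 inf_le_right (hH.1.abs_mem hh)
      -- A multiple of `w ⊓ |h|` that is at most `f` is at most `f ⊓ z`, so the next one is
      -- at most `f ⊓ z + w = f`.
      refine le_antisymm (hF _ f fun n => ?_) hv0
      induction n with
      | zero => rwa [zero_smul]
      | succ n ih =>
        have h1 : n • (w ⊓ |h|) ≤ z :=
          hz ⟨nsmul_mem hvH n, nsmul_nonneg hv0 n, ih⟩
        calc (n + 1) • (w ⊓ |h|) = n • (w ⊓ |h|) + w ⊓ |h| := succ_nsmul _ _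
          _ ≤ f ⊓ z + w := add_le_add (le_inf ih h1) inf_le_left
          _ = f := by rw [hw]; abel
    have hw_eq : w = 0 := Disj.eq_zero (hdd.mem_of_nonneg_of_le hw0 hwf hf w hwd)
    exact inf_eq_left.1 (sub_eq_zero.1 hw_eq).symm
  intro f hf
  rw [← posPart_sub_negPart f]
  exact H.sub_mem (key _ (hdd (abs_posPart_le f) hf) (posPart_nonneg f))
    (key _ (hdd (abs_negPart_le f) hf) (negPart_nonneg f))

theorem isBandGeneratedBy_disjCompl_disjCompl (hF : IsArchimedean F) (S : Set F) :
    IsBandGeneratedBy (disjComplSubmodule (disjCompl S)) S :=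
  ⟨⟨isBand_disjComplSubmodule _, subset_disjCompl_disjCompl S⟩, fun _ hB =>
    (disjCompl_anti (disjCompl_anti hB.2)).trans (hB.1.disjCompl_disjCompl_subset hF)⟩

theorem IsIdeal.isProjectionBand_of_nonneg {H : Submodule ℝ F} (hH : IsIdeal H)
    (h : ∀ f : F, 0 ≤ f → ∃ g ∈ H, f - g ∈ disjCompl (H : Set F)) : IsProjectionBand H := by
  refine ⟨hH, fun f => ?_⟩
  obtain ⟨g₁, hg₁, hd₁⟩ := h f⁺ (posPart_nonneg f)
  obtain ⟨g₂, hg₂, hd₂⟩ := h f⁻ (negPart_nonneg f)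
  refine ⟨g₁ - g₂, H.sub_mem hg₁ hg₂, (f⁺ - g₁) - (f⁻ - g₂),
    (disjComplSubmodule (H : Set F)).sub_mem hd₁ hd₂, ?_⟩
  conv_lhs => rw [← posPart_sub_negPart f]
  abel

/-- If the double disjoint complement of an order bounded set is a projection band, then it
contains an upper bound of the set, namely the projection of any upper bound. -/
theorem exists_upperBound_of_isProjectionBand {G : Set F} (hG : IsOrderBounded G)
    (h : IsProjectionBand (disjComplSubmodule (disjCompl G))) :
    ∃ g ∈ disjCompl (disjCompl G), ∀ x ∈ G, x ≤ g := by
  obtain ⟨a, b, hab⟩ := hG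
  obtain ⟨g, hg, k, hk, rfl⟩ := h.2 b
  refine ⟨g, hg, fun x hx => ?_⟩
  have hgx : g - x ∈ disjComplSubmodule (disjCompl G) :=
    Submodule.sub_mem _ hg (subset_disjCompl_disjCompl G hx)
  refine sub_nonneg.1 (Disj.nonneg_of_add_nonneg (hk _ hgx).symm ?_)
  rw [← add_sub_right_comm]
  exact sub_nonneg.2 (hab hx).2

/-! ### Projections onto principal bands -/

/-- The condition that a countable order bounded disjoint set `G` has an upper bound in `Gᵈᵈ`
yields projections onto principal bands `eᵈᵈ`. -/
theorem exists_principal_projection (hF : IsArchimedean F)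
    (hC : ∀ G : Set F, G.Countable → IsOrderBounded G → IsDisjointSet G →
      ∃ g ∈ disjCompl (disjCompl G), ∀ x ∈ G, x ≤ g) (e : F) {f : F} (hf : 0 ≤ f) :
    ∃ g ∈ disjCompl (disjCompl {e}), 0 ≤ g ∧ g ≤ f ∧ Disj (f - g) e := by
  have hI := (isBand_disjComplSubmodule (disjCompl {e})).1
  have he : |e| ∈ disjComplSubmodule (disjCompl {e}) :=
    hI.abs_mem (subset_disjCompl_disjCompl {e} rfl)
  -- Windows whose indices differ by at least `3` are disjoint.
  have hc : ∀ c : ℕ, ∃ g ∈ disjComplSubmodule (disjCompl {e}),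
      ∀ i : ℕ, window |e| f (3 * i + c) ≤ g := by
    intro c
    obtain ⟨g, hg, hle⟩ := hC (Set.range fun i : ℕ => window |e| f (3 * i + c))
      (Set.countable_range _)
      ⟨0, f, by rintro _ ⟨i, rfl⟩; exact ⟨window_nonneg hf _, window_le _ _ _⟩⟩
      (by
        rintro _ ⟨i, rfl⟩ _ ⟨j, rfl⟩ hij
        have hne : i ≠ j := fun h => hij (by rw [h])
        rcases hne.lt_or_gt with h | h
        · exact disj_window_window (abs_nonneg e) hf (by omega)
        · exact (disj_window_window (abs_nonneg e) hf (by omega)).symm)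
    refine ⟨g, fun z hz => hg z fun w hw => ?_, fun i => hle _ ⟨i, rfl⟩⟩
    obtain ⟨i, rfl⟩ := hw
    exact (hI.mem_of_nonneg_of_le (window_nonneg hf _) (window_le_nsmul (abs_nonneg e) hf _)
      (nsmul_mem he _) z hz).symm
  choose g hg hle using hc
  set u := |g 0| + |g 1| + |g 2| with hu
  have huI : u ∈ disjComplSubmodule (disjCompl {e}) :=
    add_mem (add_mem (hI.abs_mem (hg 0)) (hI.abs_mem (hg 1))) (hI.abs_mem (hg 2))
  have hgu : ∀ c < 3, g c ≤ u := by
    intro c hc3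
    have h0 := abs_nonneg (g 0)
    have h1 := abs_nonneg (g 1)
    have h2 := abs_nonneg (g 2)
    refine (le_abs_self _).trans ?_
    interval_cases c
    · exact (le_add_of_nonneg_right h1).trans (le_add_of_nonneg_right h2)
    · exact (le_add_of_nonneg_left h0).trans (le_add_of_nonneg_right h2)
    · exact le_add_of_nonneg_left (add_nonneg h0 h1)
  have hu0 : 0 ≤ u := by positivity
  have hwu : ∀ n, window |e| f n ≤ u ⊓ f := fun n => by
    refine le_inf (le_trans ?_ (hgu (n % 3) (Nat.mod_lt _ (by norm_num)))) (window_le _ _ _)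
    have := hle (n % 3) (n / 3)
    rwa [Nat.div_add_mod] at this
  refine ⟨u ⊓ f, hI.mem_of_nonneg_of_le (le_inf hu0 hf) inf_le_left huI, le_inf hu0 hf,
    inf_le_right, ?_⟩
  have hfu : 0 ≤ f - u ⊓ f := sub_nonneg.2 inf_le_right
  rw [Disj, abs_of_nonneg hfu]
  exact eq_zero_of_le_sub_window hF hf (le_inf hfu (abs_nonneg e)) inf_le_right fun n =>
    inf_le_left.trans (sub_le_sub_left (hwu n) f)

/-! ### Gluing principal projections along a disjoint set -/

/-- If `D` is a disjoint subset of a band `H` with `Dᵈ ⊆ Hᵈ`, then `H` is a projection band as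
soon as vectors can be projected onto the principal bands `dᵈᵈ`, `d ∈ D`, and the disjoint sets
of the resulting projections have upper bounds in their double disjoint complements. -/
theorem isProjectionBand_of_disjoint_generators (hF : IsArchimedean F) {H : Submodule ℝ F}
    (hH : IsBand H) {D : Set F} (hDH : D ⊆ H) (hD : IsDisjointSet D)
    (hDd : disjCompl D ⊆ disjCompl (H : Set F))
    (hP : ∀ e f : F, 0 ≤ f → ∃ g ∈ disjCompl (disjCompl {e}), 0 ≤ g ∧ g ≤ f ∧ Disj (f - g) e)
    (hC : ∀ p : F → F, IsOrderBounded (p '' D) → IsDisjointSet (p '' D) →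
      ∃ g ∈ disjCompl (disjCompl (p '' D)), ∀ x ∈ p '' D, x ≤ g) :
    IsProjectionBand H := by
  refine hH.1.isProjectionBand_of_nonneg fun f hf => ?_
  choose p hpd hp0 hpf hpe using fun e => hP e f hf
  have hpH : p '' D ⊆ H := by
    rintro _ ⟨d, hd, rfl⟩
    exact hH.disjCompl_disjCompl_subset hF
      (disjCompl_anti (disjCompl_anti (Set.singleton_subset_iff.2 (hDH hd))) (hpd d))
  have hdisj : IsDisjointSet (p '' D) := by
    rintro _ ⟨d, hd, rfl⟩ _ ⟨d', hd', rfl⟩ hne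
    have hdd' : Disj d d' := hD hd hd' fun h => hne (by rw [h])
    refine hpd d _ fun z hz => ?_
    rw [Set.mem_singleton_iff.1 hz]
    refine hpd d' d fun z' hz' => ?_
    rw [Set.mem_singleton_iff.1 hz']
    exact hdd'
  obtain ⟨g, hg, hle⟩ := hC p
    ⟨0, f, by rintro _ ⟨d, -, rfl⟩; exact ⟨hp0 d, hpf d⟩⟩ hdisj
  have hgH : g ∈ H :=
    hH.disjCompl_disjCompl_subset hF (disjCompl_anti (disjCompl_anti hpH) hg)
  have hk0 : 0 ≤ |g| ⊓ f := le_inf (abs_nonneg g) hf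
  refine ⟨|g| ⊓ f, hH.1.mem_of_nonneg_of_le hk0 inf_le_left (hH.1.abs_mem hgH), ?_⟩
  refine hDd fun d hd => (hpe d).mono_left ?_
  rw [abs_of_nonneg (sub_nonneg.2 inf_le_right), abs_of_nonneg (sub_nonneg.2 (hpf d))]
  exact sub_le_sub_left
    (le_inf ((hle _ ⟨d, hd, rfl⟩).trans (le_abs_self g)) (hpf d)) f

/-- Given projections onto principal bands, a sequence `s` can be replaced by a disjoint sequence
with the same disjoint complement, the `n`-th term being the component of `|s n|` disjoint from
`s 0, …, s (n - 1)`. -/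
theorem exists_disjoint_sequence
    (hP : ∀ e f : F, 0 ≤ f → ∃ g ∈ disjCompl (disjCompl {e}), 0 ≤ g ∧ g ≤ f ∧ Disj (f - g) e)
    (s : ℕ → F) :
    ∃ t : ℕ → F, (∀ n, 0 ≤ t n ∧ t n ≤ |s n|) ∧ IsDisjointSet (Set.range t) ∧
      disjCompl (Set.range t) ⊆ disjCompl (Set.range s) := by
  choose p hpd hp0 hpf hpe using hP
  let u : ℕ → F := fun n => ∑ i ∈ Finset.range n, |s i|
  let w : ℕ → F := fun n => p (u n) |s n| (abs_nonneg _)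
  have ht0 : ∀ n, 0 ≤ |s n| - w n := fun n => sub_nonneg.2 (hpf _ _ _)
  have hts : ∀ n, |s n| - w n ≤ |s n| := fun n => sub_le_self _ (hp0 _ _ _)
  have hdisj : ∀ m n, m < n → Disj (|s n| - w n) (|s m| - w m) := fun m n hmn => by
    refine (hpe (u n) |s n| (abs_nonneg _)).mono_right ?_
    rw [abs_of_nonneg (ht0 m)]
    exact (hts m).trans ((Finset.single_le_sum (f := fun i => |s i|)
      (fun i _ => abs_nonneg (s i)) (Finset.mem_range.2 hmn)).trans (le_abs_self _))
  refine ⟨fun n => |s n| - w n, fun n => ⟨ht0 n, hts n⟩, ?_, ?_⟩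
  · rintro _ ⟨m, rfl⟩ _ ⟨n, rfl⟩ hne
    have hmn : m ≠ n := fun h => hne (by rw [h])
    rcases hmn.lt_or_gt with h | h
    · exact (hdisj m n h).symm
    · exact hdisj n m h
  · rintro x hx _ ⟨n, rfl⟩
    induction n using Nat.strong_induction_on with
    | _ n ih =>
      have hxu : Disj x (u n) := by
        refine Disj.symm (Submodule.sum_mem (disjComplSubmodule {x}) (fun i hi z hz => ?_) x rfl)
        rw [Set.mem_singleton_iff.1 hz]
        exact ((ih i (Finset.mem_range.1 hi)).mono_right (abs_abs _).le).symm
      have hxw : Disj x (w n) :=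
        (hpd (u n) |s n| (abs_nonneg _) x (by rintro _ rfl; exact hxu)).symm
      have := (hx _ ⟨n, rfl⟩).add_right hxw
      rw [sub_add_cancel] at this
      exact this.mono_right (abs_abs _).ge

theorem hasPP_of_upperBounds (hF : IsArchimedean F)
    (hC : ∀ G : Set F, IsOrderBounded G → IsDisjointSet G →
      ∃ g ∈ disjCompl (disjCompl G), ∀ x ∈ G, x ≤ g) : HasPP F := by
  intro H hH
  obtain ⟨D, hDH, hD, hDd⟩ := hH.1.exists_disjoint_generators
  exact isProjectionBand_of_disjoint_generators hF hH hDH hD hDd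
    (fun e f hf => exists_principal_projection hF (fun G _ => hC G) e hf)
    fun p => hC (p '' D)

theorem hasSigmaPP_of_upperBounds (hF : IsArchimedean F)
    (hC : ∀ G : Set F, G.Countable → IsOrderBounded G → IsDisjointSet G →
      ∃ g ∈ disjCompl (disjCompl G), ∀ x ∈ G, x ≤ g) : HasSigmaPP F := by
  intro H S hS hHS
  have hP : ∀ e f : F, 0 ≤ f →
      ∃ g ∈ disjCompl (disjCompl {e}), 0 ≤ g ∧ g ≤ f ∧ Disj (f - g) e :=
    fun e f hf => exists_principal_projection hF hC e hf
  -- Adjoining `0` makes `S` the range of a sequence.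
  obtain ⟨s, hs⟩ := (hS.insert 0).exists_eq_range (Set.insert_nonempty 0 S)
  obtain ⟨t, ht, htd, hts⟩ := exists_disjoint_sequence hP s
  have hsH : ∀ n, s n ∈ H := fun n => by
    have hn : s n ∈ insert 0 S := hs ▸ Set.mem_range_self n
    rcases hn with h | h
    · rw [h]; exact H.zero_mem
    · exact hHS.1.2 h
  have hHd : disjCompl (Set.range t) ⊆ disjCompl (H : Set F) := by
    have hSs : S ⊆ Set.range s := hs ▸ Set.subset_insert 0 S
    have hle : H ≤ disjComplSubmodule (disjCompl S) :=
      hHS.2 (isBandGeneratedBy_disjCompl_disjCompl hF S).1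
    exact fun x hx h hh => (hle hh x (disjCompl_anti hSs (hts hx))).symm
  refine isProjectionBand_of_disjoint_generators hF hHS.1.1 ?_ htd hHd hP
    fun p => hC _ ((Set.countable_range t).image p)
  rintro _ ⟨n, rfl⟩
  exact hHS.1.1.1.mem_of_nonneg_of_le (ht n).1 (ht n).2 (hHS.1.1.1.abs_mem (hsH n))

theorem exists_upperBound_of_isLUB {G : Set F} (h : G.Nonempty → ∃ s, IsLUB G s) :
    ∃ g ∈ disjCompl (disjCompl G), ∀ x ∈ G, x ≤ g := by
  rcases G.eq_empty_or_nonempty with rfl | hne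
  · exact ⟨0, fun y _ => disj_zero_left y, fun x hx => hx.elim⟩
  · obtain ⟨s, hs⟩ := h hne
    exact ⟨s, (isBand_disjComplSubmodule _).2 G s (subset_disjCompl_disjCompl G) hs, hs.1⟩

end Bands

end VectorLattice

theorem corollary3p11 (F : Type*) [AddCommGroup F] [Lattice F] [IsOrderedAddMonoid F]
    [Module ℝ F] [IsOrderedModule ℝ F] (hF : VectorLattice.IsArchimedean F) :
    (VectorLattice.HasPP F ↔
      ∀ G : Set F, VectorLattice.IsOrderBounded G → VectorLattice.IsDisjointSet G →
        ∃ g ∈ VectorLattice.disjCompl (VectorLattice.disjCompl G), ∀ x ∈ G, x ≤ g) ∧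
    (VectorLattice.HasSigmaPP F ↔
      ∀ G : Set F, G.Countable → VectorLattice.IsOrderBounded G →
        VectorLattice.IsDisjointSet G →
        ∃ g ∈ VectorLattice.disjCompl (VectorLattice.disjCompl G), ∀ x ∈ G, x ≤ g) ∧
    (VectorLattice.DisjointlyComplete F → VectorLattice.HasPP F) ∧
    (VectorLattice.DisjointlySigmaComplete F → VectorLattice.HasSigmaPP F) := by
  refine ⟨⟨fun h G hb _ => ?_, VectorLattice.hasPP_of_upperBounds hF⟩,
    ⟨fun h G hc hb _ => ?_, VectorLattice.hasSigmaPP_of_upperBounds hF⟩,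
    fun h => VectorLattice.hasPP_of_upperBounds hF fun G hb hd => ?_,
    fun h => VectorLattice.hasSigmaPP_of_upperBounds hF fun G hc hb hd => ?_⟩
  · exact VectorLattice.exists_upperBound_of_isProjectionBand hb
      (h _ (VectorLattice.isBand_disjComplSubmodule _))
  · exact VectorLattice.exists_upperBound_of_isProjectionBand hb
      (h _ G hc (VectorLattice.isBandGeneratedBy_disjCompl_disjCompl hF G))
  · exact VectorLattice.exists_upperBound_of_isLUB fun hne => h G hne hb hd
  · exact VectorLattice.exists_upperBound_of_isLUB fun hne => h G hne hc hb hd
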